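/- **Setting.** Let $X=\{x_1,\dots,x_n\}\subset\mathbb R^d$ be a finite dataset (repetitions allowed) and $k\ge 1$. For a $k$-tuple of centroids $C=(c_1,\dots,c_k)$ let $\phi(C)=\sum_i\min_r\|x_i-c_r\|^2$. Let $C^*=(c^*_1,\dots,c^*_k)$ be a stationary point of batch $k$-means: there is a partition $A^*=(A^*_1,\dots,A^*_k)$ of $X$ into non-empty clusters that assigns every point to a closest $c^*_r$, and each $c^*_r$ is the mean of $A^*_r$. Write $n^*_r=|A^*_r|$, $\phi^*=\phi(C^*)$, $p^*_{\min}=\min_r n_r^*/n$, $w_r=\frac{\frac1{n_r^*}\sum_{x\in A_r^*}\|x-c_r^*\|^2}{\max_{x\in A_r^*}\|x-c_r^*\|^2}$ and $w_{\min}=\min_r w_r$ (it is assumed that no cluster consists of copies of a single point, so that every $w_r$ is defined). For any $C$ let $\Delta(C,C^*)=\min_\pi\sum_r n^*_r\|c_{\pi(r)}-c^*_r\|^2$, the minimum being over the permutations $\pi$ of $\{1,\dots,k\}$. The margin of $C^*$ is $\min_{r\ne s}\min_{x\in A^*_r\cup A^*_s}\bigl|\|\bar x-c^*_r\|-\|\bar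 x-c^*_s\|\bigr|$, where $\bar x$ is the projection of $x$ on the line joining $c^*_r$ and $c^*_s$. **Assumption (B).** $0<\alpha<1$, and for all $r\neq s$ the margin of $C^*$ is at least $f(\alpha)\sqrt{\phi^*}\bigl(\frac1{\sqrt{n_r^*}}+\frac1{\sqrt{n_s^*}}\bigr)$, where $f(\alpha)>\max\bigl\{64^2,\frac{5\alpha+5}{256\alpha},\max_{r\ne s}\frac{n_r^*}{n_s^*}\bigr\}$. **Algorithm.** Buckshot seeding: draw $m_o$ points from $X$ uniformly at random with replacement, run single linkage on them (starting from singletons, repeatedly merge two components at the smallest distance) until $k$ components are left, and let $C^0$ consist of the means of these components. Mini-batch $k$-means: at iteration $t\ge1$ draw a batch of $m$ points of $X$ uniformly at random with replacement, independently of the past, assign each of them to a closest centroid of $C^{t-1}$, and replace each centroid $c_r^{t-1}$ to which at least one point of the batch is assigned by $c_r^t=(1-\eta^t)c_r^{t-1}+\eta^t\hat c_r^t$, where $\hat c_r^t$ is the mean of the points assigned to it and $\eta^t=\frac{c'}{t+t_o}$; the other centroids do not move. Ties are broken by any fixed rules. Let $\phi^t=\phi(C^t)$. **Theorem.** Let $(X,C^*)$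 satisfy (B). Let $0<\xi<1$, $\beta\ge2$, $0<\delta<\frac1e$, and suppose that $$f(\alpha)\ge5\sqrt{\tfrac1{2w_{\min}}\ln\Bigl(\tfrac{2}{\xi p^*_{\min}}\ln\tfrac{2k}{\xi}\Bigr)},\qquad \frac{\ln\frac{2k}{\xi}}{p^*_{\min}}<m_o<\frac\xi2\exp\Bigl\{2\bigl(\tfrac{f(\alpha)}4-1\bigr)^2w_{\min}^2\Bigr\},$$ $$m>\frac{\ln(1-\sqrt\alpha)}{\ln(1-\frac45p^*_{\min})},\qquad 1-\sqrt\alpha-e^{-\frac45mp^*_{\min}}>0,$$ $$c'>\frac{\beta}{2\bigl[1-\sqrt\alpha-e^{-\frac45mp^*_{\min}}\bigr]},\qquad t_o\ge867\,(c')^2n^2\ln^2\tfrac1\delta .$$ Run mini-batch $k$-means with Buckshot seeding and these parameters. Then for every $t\ge1$ there is an event $G_t$ with $\Pr(G_t)\ge(1-\delta)(1-\xi)$ such that $$E[\phi^t\mid G_t]-\phi^*\le E[\Delta(C^t,C^*)\mid G_t]=O\bigl(\tfrac1t\bigr)\qquad(t\to\infty).$$ In particular, if $C^*$ is an optimal $k$-means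 solution, that is $\phi^*=\min_C\phi(C)$, then $E[\phi^t\mid G_t]-\min_C\phi(C)=O(\frac1t)$. -/

import Mathlib

open MeasureTheory ProbabilityTheory Filter Asymptotics

noncomputable section

namespace KMeans

/-! Throughout, a dataset is a family `x : Fin n → EuclideanSpace ℝ (Fin d)` of `n` points,
a `k`-tuple of centroids is `C : Fin k → EuclideanSpace ℝ (Fin d)`, and a clustering is given by
its labels `A : Fin n → Fin k`, so that `{i | A i = r}` is the `r`-th cluster. -/

/-- The mean of the points `y i`, `i ∈ s`. -/
def mean {ι : Type*} {d : ℕ} (y : ι → EuclideanSpace ℝ (Fin d)) (s : Finset ι) :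
    EuclideanSpace ℝ (Fin d) :=
  (s.card : ℝ)⁻¹ • ∑ i ∈ s, y i

/-- The `k`-means cost `φ(C)`: each point pays the squared distance to its closest centroid. -/
def cost {d n k : ℕ} (x : Fin n → EuclideanSpace ℝ (Fin d))
    (C : Fin k → EuclideanSpace ℝ (Fin d)) : ℝ :=
  ∑ i, ⨅ r, ‖x i - C r‖ ^ 2

/-- The `r`-th cluster of a clustering. -/
def cluster {n k : ℕ} (A : Fin n → Fin k) (r : Fin k) : Finset (Fin n) :=
  Finset.univ.filter fun i => A i = r

/-- The number `n_r` of points in the `r`-th cluster. -/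
def size {n k : ℕ} (A : Fin n → Fin k) (r : Fin k) : ℕ := (cluster A r).card

/-- The clustering `A` is induced by the Voronoi diagram of `C`, that is `A ∈ V(C) ∩ X`. -/
def IsVoronoi {d n k : ℕ} (x : Fin n → EuclideanSpace ℝ (Fin d))
    (C : Fin k → EuclideanSpace ℝ (Fin d)) (A : Fin n → Fin k) : Prop :=
  ∀ i s, ‖x i - C (A i)‖ ≤ ‖x i - C s‖

/-- `C` is a stationary point of batch `k`-means with (non-empty) clusters `A`: `A` is induced
by the Voronoi diagram of `C`, and each centroid is the mean of its cluster. -/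
structure IsStationary {d n k : ℕ} (x : Fin n → EuclideanSpace ℝ (Fin d))
    (C : Fin k → EuclideanSpace ℝ (Fin d)) (A : Fin n → Fin k) : Prop where
  voronoi : IsVoronoi x C A
  nonempty : ∀ r, (cluster A r).Nonempty
  mean_eq : ∀ r, C r = mean x (cluster A r)

/-- The centroidal distance `Δ(C', C)`, the clusters of `C` being given by `A`. -/
def centroidalDist {d n k : ℕ} (A : Fin n → Fin k)
    (C' C : Fin k → EuclideanSpace ℝ (Fin d)) : ℝ :=
  ⨅ π : Equiv.Perm (Fin k), ∑ r, (size A r : ℝ) * ‖C' (π r) - C r‖ ^ 2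

/-- The orthogonal projection of `p` on the line joining `a` and `b`. -/
def lineProj {d : ℕ} (a b p : EuclideanSpace ℝ (Fin d)) : EuclideanSpace ℝ (Fin d) :=
  (EuclideanGeometry.orthogonalProjection (affineSpan ℝ {a, b}) p : EuclideanSpace ℝ (Fin d))

/-- `Δ_rs(C)`: the minimum over `p` in the `r`-th and the `s`-th cluster of
`|‖p̄ - c_r‖ - ‖p̄ - c_s‖|`, with `p̄` the projection of `p` on the line joining `c_r`, `c_s`. -/
def pairMargin {d n k : ℕ} (x : Fin n → EuclideanSpace ℝ (Fin d))
    (C : Fin k → EuclideanSpace ℝ (Fin d)) (A : Fin n → Fin k) (r s : Fin k) : ℝ :=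
  ⨅ i : {i : Fin n // A i = r ∨ A i = s},
    |‖lineProj (C r) (C s) (x i) - C r‖ - ‖lineProj (C r) (C s) (x i) - C s‖|

/-- The margin of the Voronoi diagram of `C` with respect to the dataset: the minimum of
`Δ_rs(C)` over all pairs `r ≠ s`. -/
def margin {d n k : ℕ} (x : Fin n → EuclideanSpace ℝ (Fin d))
    (C : Fin k → EuclideanSpace ℝ (Fin d)) (A : Fin n → Fin k) : ℝ :=
  ⨅ p : {p : Fin k × Fin k // p.1 ≠ p.2}, pairMargin x C A p.1.1 p.1.2

/-- `f(α)`-clusterability of the pair (dataset, `C`), where `f` stands for the number `f(α)`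
and `A` is the clustering induced by `C`. -/
structure Clusterable {d n k : ℕ} (x : Fin n → EuclideanSpace ℝ (Fin d))
    (C : Fin k → EuclideanSpace ℝ (Fin d)) (A : Fin n → Fin k) (f α : ℝ) : Prop where
  stationary : IsStationary x C A
  alpha_pos : 0 < α
  alpha_lt_one : α < 1
  margin_ge : ∀ r s, s ≠ r →
    f * √(cost x C) * (1 / √(size A r : ℝ) + 1 / √(size A s : ℝ)) ≤ margin x C A
  gt_const : (64 : ℝ) ^ 2 < f
  gt_alpha : (5 * α + 5) / (256 * α) < f
  gt_ratio : ∀ r s, s ≠ r → (size A r : ℝ) / (size A s : ℝ) < f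

/-- `p_min`: the fraction of the points that lie in the smallest cluster. -/
def pMin {n k : ℕ} (A : Fin n → Fin k) : ℝ := ⨅ r, (size A r : ℝ) / (n : ℝ)

/-- `w_r`: the ratio between the average and the maximal squared distance to the centroid in the
`r`-th cluster. -/
def spread {d n k : ℕ} (x : Fin n → EuclideanSpace ℝ (Fin d))
    (C : Fin k → EuclideanSpace ℝ (Fin d)) (A : Fin n → Fin k) (r : Fin k) : ℝ :=
  ((∑ i ∈ cluster A r, ‖x i - C r‖ ^ 2) / (size A r : ℝ)) /
    ⨆ i : {i : Fin n // A i = r}, ‖x i - C r‖ ^ 2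

/-- `w_min`: the minimum of the `w_r`. -/
def wMin {d n k : ℕ} (x : Fin n → EuclideanSpace ℝ (Fin d))
    (C : Fin k → EuclideanSpace ℝ (Fin d)) (A : Fin n → Fin k) : ℝ :=
  ⨅ r, spread x C A r

/-! ### Single linkage and Buckshot seeding -/

/-- `P` is a list of components that single linkage may have reached on the points `y`:
it starts with singletons and repeatedly merges two components at the smallest distance
(the distance between components is the smallest distance between their points; ties are
broken in any way). -/
inductive SingleLinkage {d mo : ℕ} (y : Fin mo → EuclideanSpace ℝ (Fin d)) :
    Finset (Finset (Fin mo)) → Prop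
  | init : SingleLinkage y (Finset.univ.image fun i => {i})
  | merge (P : Finset (Finset (Fin mo))) (S T : Finset (Fin mo)) (i j : Fin mo)
      (hP : SingleLinkage y P) (hS : S ∈ P) (hT : T ∈ P) (hST : S ≠ T) (hi : i ∈ S) (hj : j ∈ T)
      (hmin : ∀ S' ∈ P, ∀ T' ∈ P, S' ≠ T' → ∀ i' ∈ S', ∀ j' ∈ T',
        ‖y i - y j‖ ≤ ‖y i' - y j'‖) :
      SingleLinkage y (insert (S ∪ T) ((P.erase S).erase T))

/-- `C` consists of the means of the components that remain when single linkage on the points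
`y` is run until `k` components are left. -/
def IsBuckshotSeed {d mo k : ℕ} (y : Fin mo → EuclideanSpace ℝ (Fin d))
    (C : Fin k → EuclideanSpace ℝ (Fin d)) : Prop :=
  ∃ P : Finset (Finset (Fin mo)), SingleLinkage y P ∧
    ∃ e : Fin k ≃ P, ∀ r, C r = mean y (e r : Finset (Fin mo))

/-! ### Mini-batch `k`-means -/

/-- `near` finds, for every tuple of centroids and every point, a closest centroid. -/
def IsNearestRule {d k : ℕ}
    (near : (Fin k → EuclideanSpace ℝ (Fin d)) → EuclideanSpace ℝ (Fin d) → Fin k) : Prop :=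
  ∀ (C : Fin k → EuclideanSpace ℝ (Fin d)) (p : EuclideanSpace ℝ (Fin d)) (s : Fin k),
    ‖p - C (near C p)‖ ≤ ‖p - C s‖

/-- One iteration of mini-batch `k`-means from the centroids `C`, with learning rate `η` and
mini-batch `b`. A centroid to which no point of the batch is assigned does not move. -/
def step {d k m : ℕ}
    (near : (Fin k → EuclideanSpace ℝ (Fin d)) → EuclideanSpace ℝ (Fin d) → Fin k)
    (η : ℝ) (C : Fin k → EuclideanSpace ℝ (Fin d)) (b : Fin m → EuclideanSpace ℝ (Fin d)) :
    Fin k → EuclideanSpace ℝ (Fin d) := fun r =>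
  let s : Finset (Fin m) := Finset.univ.filter fun j => near C (b j) = r
  if s.Nonempty then (1 - η) • C r + η • mean b s else C r

/-- The centroids `C^t` after `t` iterations, from the seeds `C0`, with learning rate `η t` at
iteration `t ≥ 1` and with `b t` the mini-batch of iteration `t + 1`. -/
def run {d k m : ℕ}
    (near : (Fin k → EuclideanSpace ℝ (Fin d)) → EuclideanSpace ℝ (Fin d) → Fin k)
    (η : ℕ → ℝ) (C0 : Fin k → EuclideanSpace ℝ (Fin d))
    (b : ℕ → Fin m → EuclideanSpace ℝ (Fin d)) : ℕ → Fin k → EuclideanSpace ℝ (Fin d)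
  | 0 => C0
  | t + 1 => step near (η (t + 1)) (run near η C0 b t) (b t)

/-- All the draws, of the seeding sample `ν` and of the mini-batches `S t`, are independent and
uniformly distributed on the (indices of the) data points. -/
structure IsUniformSampling {Ω : Type*} [MeasurableSpace Ω] (μ : Measure Ω) {n mo m : ℕ}
    (ν : Fin mo → Ω → Fin n) (S : ℕ → Fin m → Ω → Fin n) : Prop where
  measurable_seed : ∀ i, Measurable (ν i)
  measurable_batch : ∀ t j, Measurable (S t j)
  law_seed : ∀ i, μ.map (ν i) = uniformOn Set.univ
  law_batch : ∀ t j, μ.map (S t j) = uniformOn Set.univ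
  indep : iIndepFun (fun q : Fin mo ⊕ (ℕ × Fin m) =>
    Sum.elim ν (fun p => S p.1 p.2) q) μ

/-- The random centroids `C^t(ω)` of mini-batch `k`-means on the dataset `x`, seeded by `seed`
from the sample `ν`, with learning rate `c' / (t + t_o)`. -/
def iterate {Ω : Type*} {d n k mo m : ℕ} (x : Fin n → EuclideanSpace ℝ (Fin d))
    (seed : (Fin mo → EuclideanSpace ℝ (Fin d)) → Fin k → EuclideanSpace ℝ (Fin d))
    (near : (Fin k → EuclideanSpace ℝ (Fin d)) → EuclideanSpace ℝ (Fin d) → Fin k)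
    (c' t_o : ℝ) (ν : Fin mo → Ω → Fin n) (S : ℕ → Fin m → Ω → Fin n) (t : ℕ) (ω : Ω) :
    Fin k → EuclideanSpace ℝ (Fin d) :=
  run near (fun t : ℕ => c' / ((t : ℝ) + t_o)) (seed fun i => x (ν i ω))
    (fun t j => x (S t j ω)) t

end KMeans

end

open KMeans

/-!
The lower bound on `f(α)` in terms of `w_min` makes the data well separated in a deterministic
sense. By the definition of `w_r` the `r`-th cluster has radius at most
`ρ r = √(φ* / (n_r w_min))`, while the margin is at least `f(α) √w_min (ρ r + ρ s)`, and
`f(α) √w_min ≥ 3` as soon as there are two clusters (`three_le_mul_sqrt`). A point is at least the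
margin away from the centroids of the other clusters (`IsVoronoi.margin_le`), so distances within
clusters are smaller than distances between clusters, and the closest centroid of a point does not
change when every `c*_r` moves by at most `ρ r` (`Clusterable.wellSeparated`).

The events `G_t` are all the same: the seeding sample hits every cluster. The lower bound on `m_o`
gives it a probability of at least `1 - ξ / 2`, by a union bound
(`IsUniformSampling.le_real_seedHits`). On this event single linkage finds exactly the clusters
(`SingleLinkage.exists_label`), so the seeds are, up to a relabelling, within `ρ r` of the `c*_r`,
and all the iterates stay there: each of them is assigned the right points, and it moves towards
the mean of points of its cluster (`WellSeparated.closeTo_run`).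

Mini-batch `k`-means is then plain stochastic approximation in each cluster. The mean of the points
of a batch in a cluster is an unbiased estimate of the centroid (`IsStationary.sum_batchDev`), so
the weighted mean squared distance `u_t` to the stationary point satisfies
`u_{t+1} ≤ (1 - q η) u_t + η² W` with `η = c' / (t + 1 + t_o)`, where
`q = 1 - exp (-4/5 m p_min)` bounds from below the probability that a batch hits a given cluster
(`IsUniformSampling.integral_seededDist_succ_le`). The condition on `c'` gives `q c' > 1`, which is
what makes `u_t = O(1/t)` (`exists_le_div_of_recursion`). Finally `φ(C) - φ* ≤ Δ(C, C*)` for every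
`C` (`IsStationary.cost_sub_le`).
-/

namespace KMeans

/-! ### Geometry of a clusterable stationary point -/

section Geometry

variable {d n k : ℕ} {x : Fin n → EuclideanSpace ℝ (Fin d)}
  {C : Fin k → EuclideanSpace ℝ (Fin d)} {A : Fin n → Fin k}

theorem mem_cluster {i : Fin n} {r : Fin k} : i ∈ cluster A r ↔ A i = r := by
  simp [cluster]

/-- Moving the origin to an arbitrary point `c` commutes with taking a mean. -/
theorem mean_sub {ι : Type*} (y : ι → EuclideanSpace ℝ (Fin d)) {s : Finset ι}
    (hs : s.Nonempty) (c : EuclideanSpace ℝ (Fin d)) :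
    mean y s - c = (s.card : ℝ)⁻¹ • ∑ i ∈ s, (y i - c) := by
  have h : (s.card : ℝ) ≠ 0 := by exact_mod_cast hs.card_pos.ne'
  rw [Finset.sum_sub_distrib, Finset.sum_const, smul_sub, ← Nat.cast_smul_eq_nsmul ℝ, smul_smul,
    inv_mul_cancel₀ h, one_smul, mean]

theorem norm_smul_sum_sub_le {ι : Type*} (y : ι → EuclideanSpace ℝ (Fin d)) (s : Finset ι)
    (c : EuclideanSpace ℝ (Fin d)) {ρ : ℝ} (hρ : 0 ≤ ρ) (h : ∀ i ∈ s, ‖y i - c‖ ≤ ρ) :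
    ‖(s.card : ℝ)⁻¹ • ∑ i ∈ s, (y i - c)‖ ≤ ρ := by
  rw [norm_smul, norm_inv, Real.norm_natCast]
  have h1 : ‖∑ i ∈ s, (y i - c)‖ ≤ s.card * ρ := by
    simpa using norm_sum_le_of_le s h
  rcases s.eq_empty_or_nonempty with rfl | hs
  · simpa using hρ
  · have h2 : (0 : ℝ) < s.card := by exact_mod_cast hs.card_pos
    rw [inv_mul_le_iff₀ h2]
    exact h1

/-- A mean of points of a ball lies in the ball. -/
theorem norm_mean_sub_le {ι : Type*} (y : ι → EuclideanSpace ℝ (Fin d)) {s : Finset ι}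
    (hs : s.Nonempty) (c : EuclideanSpace ℝ (Fin d)) {ρ : ℝ} (hρ : 0 ≤ ρ)
    (h : ∀ i ∈ s, ‖y i - c‖ ≤ ρ) : ‖mean y s - c‖ ≤ ρ := by
  rw [mean_sub y hs]
  exact norm_smul_sum_sub_le y s c hρ h

theorem IsStationary.sum_sub_eq_zero (h : IsStationary x C A) (r : Fin k) :
    ∑ i ∈ cluster A r, (x i - C r) = 0 := by
  have h1 := mean_sub x (h.nonempty r) (C r)
  rw [← h.mean_eq r, sub_self] at h1
  have h2 : ((cluster A r).card : ℝ) ≠ 0 := by exact_mod_cast (h.nonempty r).card_pos.ne'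
  exact (smul_eq_zero.1 h1.symm).resolve_left (inv_ne_zero h2)

theorem IsStationary.size_pos (h : IsStationary x C A) (r : Fin k) : (0 : ℝ) < size A r := by
  exact_mod_cast (h.nonempty r).card_pos

theorem IsVoronoi.cost_eq (h : IsVoronoi x C A) : cost x C = ∑ i, ‖x i - C (A i)‖ ^ 2 := by
  refine Finset.sum_congr rfl fun i _ => le_antisymm (ciInf_le (Set.finite_range _).bddBelow _) ?_
  have : Nonempty (Fin k) := ⟨A i⟩
  exact le_ciInf fun s => pow_le_pow_left₀ (norm_nonneg _) (h i s) 2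

theorem sum_eq_sum_cluster (g : Fin n → Fin k → ℝ) :
    ∑ i, g i (A i) = ∑ r, ∑ i ∈ cluster A r, g i r := by
  rw [← Finset.sum_fiberwise Finset.univ A]
  refine Finset.sum_congr rfl fun r _ => Finset.sum_congr rfl fun i hi => ?_
  rw [(Finset.mem_filter.1 hi).2]

/-- Huygens' identity: the sum of the squared distances to a point `c` exceeds its minimum,
attained at the mean, by the squared distance from `c` to the mean, weighted by the size. -/
theorem IsStationary.sum_sq_eq (h : IsStationary x C A) (r : Fin k)
    (c : EuclideanSpace ℝ (Fin d)) :
    ∑ i ∈ cluster A r, ‖x i - c‖ ^ 2 =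
      ∑ i ∈ cluster A r, ‖x i - C r‖ ^ 2 + size A r * ‖c - C r‖ ^ 2 := by
  have h1 : ∀ i, ‖x i - c‖ ^ 2 =
      ‖x i - C r‖ ^ 2 - 2 * inner ℝ (x i - C r) (c - C r) + ‖c - C r‖ ^ 2 := fun i => by
    rw [← norm_sub_sq_real]; congr 2; abel
  simp_rw [h1, Finset.sum_add_distrib, Finset.sum_sub_distrib, ← Finset.mul_sum, ← sum_inner,
    h.sum_sub_eq_zero r]
  simp [size]

theorem centroidalDist_le (C' : Fin k → EuclideanSpace ℝ (Fin d)) (π : Equiv.Perm (Fin k)) :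
    centroidalDist A C' C ≤ ∑ r, (size A r : ℝ) * ‖C' (π r) - C r‖ ^ 2 :=
  ciInf_le (f := fun π : Equiv.Perm (Fin k) => ∑ r, (size A r : ℝ) * ‖C' (π r) - C r‖ ^ 2)
    (Set.finite_range _).bddBelow π

theorem centroidalDist_nonneg (C' : Fin k → EuclideanSpace ℝ (Fin d)) :
    0 ≤ centroidalDist A C' C :=
  Real.iInf_nonneg fun _ => Finset.sum_nonneg fun _ _ => by positivity

/-- Keeping the clusters of the stationary point, but with the centroids `C'`, costs
`φ(C) + Δ(C', C)`, and the assignment to closest centroids can only be cheaper. -/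
theorem IsStationary.cost_sub_le (h : IsStationary x C A) (C' : Fin k → EuclideanSpace ℝ (Fin d)) :
    cost x C' - cost x C ≤ centroidalDist A C' C := by
  refine le_ciInf fun π => ?_
  have h1 : cost x C' ≤ ∑ i, ‖x i - C' (π (A i))‖ ^ 2 :=
    Finset.sum_le_sum fun i _ => ciInf_le (f := fun r => ‖x i - C' r‖ ^ 2)
      (Set.finite_range _).bddBelow _
  rw [sum_eq_sum_cluster fun i r => ‖x i - C' (π r)‖ ^ 2] at h1
  rw [h.voronoi.cost_eq, sum_eq_sum_cluster fun i r => ‖x i - C r‖ ^ 2]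
  simp_rw [h.sum_sq_eq _ (C' (π _)), Finset.sum_add_distrib] at h1
  linarith

/-- The data lie so close to their centroids, compared to the gaps between the clusters, that
even after each centroid `C r` has moved by at most `ρ r` no point changes its closest centroid,
and that points of one cluster are closer to each other than points of different clusters. -/
structure WellSeparated (x : Fin n → EuclideanSpace ℝ (Fin d))
    (C : Fin k → EuclideanSpace ℝ (Fin d)) (A : Fin n → Fin k) (ρ : Fin k → ℝ) : Prop where
  radius_le : ∀ i, ‖x i - C (A i)‖ ≤ ρ (A i)
  radius_nonneg : ∀ r, 0 ≤ ρ r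
  center_gap : ∀ i s, A i ≠ s → 2 * ρ (A i) + ρ s < ‖x i - C s‖
  point_gap : ∀ i j u, A i ≠ A j → 2 * ρ u < ‖x i - x j‖

theorem norm_lineProj_sub_sq {a b c : EuclideanSpace ℝ (Fin d)} (p : EuclideanSpace ℝ (Fin d))
    (hc : c ∈ affineSpan ℝ {a, b}) :
    ‖p - c‖ ^ 2 = ‖lineProj a b p - c‖ ^ 2 + ‖p - lineProj a b p‖ ^ 2 := by
  have := EuclideanGeometry.dist_sq_eq_dist_orthogonalProjection_sq_add_dist_orthogonalProjection_sq
    p hc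
  rw [dist_comm c p, dist_comm c] at this
  simp only [dist_eq_norm] at this
  simp only [lineProj, sq]
  exact this

/-- Every point is at least the margin away from the centroids of the other clusters: the bound
holds for its projection on the line joining the two centroids, and projecting on a line
decreases the distances to the points of the line. -/
theorem IsVoronoi.margin_le (h : IsVoronoi x C A) {i : Fin n} {s : Fin k} (hs : A i ≠ s) :
    margin x C A ≤ ‖x i - C s‖ := by
  have h1 : margin x C A ≤ pairMargin x C A (A i) s :=
    ciInf_le (f := fun p : {p : Fin k × Fin k // p.1 ≠ p.2} => pairMargin x C A p.1.1 p.1.2)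
      (Set.finite_range _).bddBelow ⟨(A i, s), hs⟩
  have h2 : pairMargin x C A (A i) s ≤ |‖lineProj (C (A i)) (C s) (x i) - C (A i)‖ -
      ‖lineProj (C (A i)) (C s) (x i) - C s‖| :=
    ciInf_le (f := fun j : {j : Fin n // A j = A i ∨ A j = s} =>
      |‖lineProj (C (A i)) (C s) (x j) - C (A i)‖ - ‖lineProj (C (A i)) (C s) (x j) - C s‖|)
      (Set.finite_range _).bddBelow ⟨i, Or.inl rfl⟩
  have e1 := norm_lineProj_sub_sq (a := C (A i)) (b := C s) (x i)
    (left_mem_affineSpan_pair ℝ (C (A i)) (C s))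
  have e2 := norm_lineProj_sub_sq (a := C (A i)) (b := C s) (x i)
    (right_mem_affineSpan_pair ℝ (C (A i)) (C s))
  have h3 := pow_le_pow_left₀ (norm_nonneg _) (h i s) 2
  have h4 : ‖lineProj (C (A i)) (C s) (x i) - C (A i)‖ ≤ ‖lineProj (C (A i)) (C s) (x i) - C s‖ :=
    le_of_sq_le_sq (by linarith) (norm_nonneg _)
  have h5 : ‖lineProj (C (A i)) (C s) (x i) - C s‖ ≤ ‖x i - C s‖ :=
    le_of_sq_le_sq (by nlinarith [sq_nonneg ‖x i - lineProj (C (A i)) (C s) (x i)‖])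
      (norm_nonneg _)
  rw [abs_of_nonpos (by linarith)] at h2
  linarith [norm_nonneg (lineProj (C (A i)) (C s) (x i) - C (A i))]

theorem IsVoronoi.sum_cluster_le_cost (h : IsVoronoi x C A) (r : Fin k) :
    ∑ i ∈ cluster A r, ‖x i - C r‖ ^ 2 ≤ cost x C := by
  rw [h.cost_eq, sum_eq_sum_cluster fun i r => ‖x i - C r‖ ^ 2]
  exact Finset.single_le_sum (f := fun r => ∑ i ∈ cluster A r, ‖x i - C r‖ ^ 2)
    (fun r _ => Finset.sum_nonneg fun i _ => by positivity) (Finset.mem_univ r)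

theorem IsVoronoi.cost_pos (h : IsVoronoi x C A) {i : Fin n} (hi : x i ≠ C (A i)) :
    0 < cost x C := by
  refine lt_of_lt_of_le ?_ (h.sum_cluster_le_cost (A i))
  refine Finset.sum_pos' (fun i _ => by positivity) ⟨i, mem_cluster.2 rfl, ?_⟩
  have : 0 < ‖x i - C (A i)‖ := norm_pos_iff.2 (sub_ne_zero.2 hi)
  positivity

theorem sq_norm_le_iSup (i : Fin n) :
    ‖x i - C (A i)‖ ^ 2 ≤ ⨆ j : {j : Fin n // A j = A i}, ‖x j - C (A i)‖ ^ 2 :=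
  le_ciSup (f := fun j : {j : Fin n // A j = A i} => ‖x j - C (A i)‖ ^ 2)
    (Set.finite_range _).bddAbove ⟨i, rfl⟩

theorem wMin_pos (hk : 0 < k) (hw : ∀ r, ∃ i, A i = r ∧ x i ≠ C r) : 0 < wMin x C A := by
  have : Nonempty (Fin k) := ⟨⟨0, hk⟩⟩
  obtain ⟨r, hr⟩ := exists_eq_ciInf_of_finite (f := fun r => spread x C A r)
  rw [wMin, ← hr]
  obtain ⟨i, rfl, hi⟩ := hw r
  have h1 : 0 < ‖x i - C (A i)‖ := norm_pos_iff.2 (sub_ne_zero.2 hi)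
  have h2 : 0 < ∑ i' ∈ cluster A (A i), ‖x i' - C (A i)‖ ^ 2 :=
    Finset.sum_pos' (fun i _ => by positivity) ⟨i, mem_cluster.2 rfl, by positivity⟩
  have h3 : (0 : ℝ) < size A (A i) := by
    exact_mod_cast Finset.card_pos.2 ⟨i, mem_cluster.2 rfl⟩
  have h4 := lt_of_lt_of_le (pow_pos h1 2) (sq_norm_le_iSup (C := C) i)
  exact div_pos (div_pos h2 h3) h4

/-- By the definition of `w_r` the radius of a cluster is at most `√(φ / (n_r w_r))`. -/
theorem IsStationary.norm_sub_le (h : IsStationary x C A)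
    (hw : ∀ r, ∃ i, A i = r ∧ x i ≠ C r) (i : Fin n) :
    ‖x i - C (A i)‖ ≤ √(cost x C / (size A (A i) * wMin x C A)) := by
  have hw0 := wMin_pos (A i).pos hw
  have hn := h.size_pos (A i)
  refine Real.le_sqrt_of_sq_le ((sq_norm_le_iSup i).trans ?_)
  have h1 : wMin x C A ≤ spread x C A (A i) := ciInf_le (Set.finite_range _).bddBelow _
  obtain ⟨j, hj, hjx⟩ := hw (A i)
  have h2 : 0 < ⨆ j : {j : Fin n // A j = A i}, ‖x j - C (A i)‖ ^ 2 := by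
    have := sq_norm_le_iSup (x := x) (C := C) (A := A) j
    rw [hj] at this
    have h3 : 0 < ‖x j - C (A i)‖ := norm_pos_iff.2 (sub_ne_zero.2 hjx)
    exact lt_of_lt_of_le (pow_pos h3 2) this
  rw [spread, le_div_iff₀ h2, le_div_iff₀ hn] at h1
  rw [le_div_iff₀ (by positivity)]
  linarith [h.voronoi.sum_cluster_le_cost (A i)]

theorem pMin_le (r : Fin k) : pMin A ≤ (size A r : ℝ) / n :=
  ciInf_le (Set.finite_range _).bddBelow r

theorem IsStationary.pMin_pos (h : IsStationary x C A) (hk : 0 < k) : 0 < pMin A := by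
  have : Nonempty (Fin k) := ⟨⟨0, hk⟩⟩
  obtain ⟨r, hr⟩ := exists_eq_ciInf_of_finite (f := fun r => (size A r : ℝ) / (n : ℝ))
  rw [pMin, ← hr]
  obtain ⟨i, -⟩ := h.nonempty r
  have : (0 : ℝ) < n := by exact_mod_cast i.pos
  have := h.size_pos r
  positivity

theorem sum_size : ∑ r, size A r = n := by
  have := Finset.card_eq_sum_card_fiberwise (f := A) (s := Finset.univ) (t := Finset.univ)
    (fun _ _ => Finset.mem_coe.2 (Finset.mem_univ _))
  simpa [size, cluster] using this.symm

theorem pMin_mul_le_one : pMin A * k ≤ 1 := by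
  have h1 : ∑ r : Fin k, pMin A ≤ ∑ r, (size A r : ℝ) / n := Finset.sum_le_sum fun r _ => pMin_le r
  rw [← Finset.sum_div, ← Nat.cast_sum, sum_size, Finset.sum_const, nsmul_eq_mul] at h1
  simp only [Finset.card_univ, Fintype.card_fin] at h1
  linarith [div_self_le_one (n : ℝ)]

/-- With at least two clusters the lower bound on `f(α)` involving `w_min` amounts to
`f(α) ≥ 3 / √w_min`. -/
theorem three_le_mul_sqrt {f ξ w p : ℝ} (hk : 2 ≤ k) (hw : 0 < w) (hp : 0 < p) (hpk : p * k ≤ 1)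
    (hξ0 : 0 < ξ) (hξ1 : ξ < 1)
    (hf : 5 * √(1 / (2 * w) * Real.log (2 / (ξ * p) * Real.log (2 * k / ξ))) ≤ f) :
    3 ≤ f * √w := by
  have hk' : (2 : ℝ) ≤ k := by exact_mod_cast hk
  have hl2 := Real.log_two_gt_d9
  have hlog : 1.2 ≤ Real.log (2 * k / ξ) := by
    have h4 : Real.log 4 = 2 * Real.log 2 := by
      rw [show (4 : ℝ) = 2 ^ 2 by norm_num, Real.log_pow]; norm_num
    have : Real.log 4 ≤ Real.log (2 * k / ξ) := by
      refine Real.log_le_log (by norm_num) ?_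
      rw [le_div_iff₀ hξ0]; nlinarith
    linarith
  have hfrac : 4 ≤ 2 / (ξ * p) := by
    rw [le_div_iff₀ (by positivity)]
    nlinarith [mul_pos hξ0 hp]
  have hL : 1 ≤ Real.log (2 / (ξ * p) * Real.log (2 * k / ξ)) := by
    rw [Real.le_log_iff_exp_le (by positivity)]
    have := Real.exp_one_lt_d9
    nlinarith
  have h1 : 5 * √(1 / (2 * w)) ≤ f := by
    refine le_trans ?_ hf
    gcongr
    exact le_mul_of_one_le_right (by positivity) hL
  have h2 : √(1 / (2 * w)) * √w = √(1 / 2) := by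
    rw [← Real.sqrt_mul (by positivity)]
    congr 1
    field_simp
  have h3 : (3 / 5 : ℝ) ≤ √(1 / 2) := Real.le_sqrt_of_sq_le (by norm_num)
  calc (3 : ℝ) ≤ 5 * √(1 / (2 * w)) * √w := by rw [mul_assoc, h2]; linarith
    _ ≤ f * √w := by gcongr

/-- A clusterable stationary point is well separated for the radii `√(φ / (n_r w_min))`. -/
theorem Clusterable.wellSeparated {f α ξ : ℝ} (hB : Clusterable x C A f α)
    (hw : ∀ r, ∃ i, A i = r ∧ x i ≠ C r) (hξ0 : 0 < ξ) (hξ1 : ξ < 1)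
    (hf : 5 * √(1 / (2 * wMin x C A) *
      Real.log (2 / (ξ * pMin A) * Real.log (2 * k / ξ))) ≤ f) :
    WellSeparated x C A fun r => √(cost x C / (size A r * wMin x C A)) := by
  have hst := hB.stationary
  have hrad := hst.norm_sub_le hw
  have hpos : ∀ r, 0 < √(cost x C / (size A r * wMin x C A)) := fun r => by
    obtain ⟨i, hi, hx⟩ := hw r
    have h1 := hst.voronoi.cost_pos (i := i) (by rwa [hi])
    have h2 := hst.size_pos r
    have h3 := wMin_pos r.pos hw
    positivity
  have hgap : ∀ r s, r ≠ s → 3 * (√(cost x C / (size A r * wMin x C A)) +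
      √(cost x C / (size A s * wMin x C A))) ≤ margin x C A := fun r s hrs => by
    have hk : 2 ≤ k := by
      have := (Fin.nontrivial_iff_two_le (n := k)).1 ⟨r, s, hrs⟩
      exact this
    have hw0 := wMin_pos r.pos hw
    have h3 := three_le_mul_sqrt hk hw0 (hst.pMin_pos r.pos) pMin_mul_le_one hξ0 hξ1 hf
    refine le_trans ?_ (hB.margin_ge r s hrs.symm)
    have e : ∀ u, √(cost x C) * (1 / √(size A u : ℝ)) =
        √(wMin x C A) * √(cost x C / (size A u * wMin x C A)) := fun u => by
      have h2 := hst.size_pos u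
      rw [← Real.sqrt_mul hw0.le, ← Real.sqrt_one, ← Real.sqrt_div zero_le_one,
        ← Real.sqrt_mul' _ (by positivity)]
      congr 1
      field_simp
    rw [mul_assoc f, mul_add (√(cost x C)), e, e, ← mul_add, ← mul_assoc]
    have := hpos r
    have := hpos s
    gcongr
  refine ⟨hrad, fun r => (hpos r).le, fun i s hs => ?_, fun i j u hij => ?_⟩
  · have h1 := hgap _ _ hs
    have h2 := hst.voronoi.margin_le hs
    have := hpos (A i)
    have := hpos s
    linarith
  · -- `‖x i - x j‖ ≥ M - ρ (A j)`, and both `ρ (A j)` and `ρ u` are less than `M / 3`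
    have h1 := hgap _ _ hij
    have h2 := hst.voronoi.margin_le hij
    have h3 := hrad j
    have h4 : ‖x i - C (A j)‖ ≤ ‖x i - x j‖ + ‖x j - C (A j)‖ := norm_sub_le_norm_sub_add_norm_sub ..
    have h5 : 3 * √(cost x C / (size A u * wMin x C A)) < margin x C A := by
      by_cases hu : u = A i
      · subst hu
        have := hpos (A j)
        linarith
      · have := hgap u _ hu
        have := hpos (A i)
        linarith
    have := hpos (A i)
    linarith

end Geometry

/-! ### Single linkage on well separated data -/

section Linkage

variable {d n k mo : ℕ} {x : Fin n → EuclideanSpace ℝ (Fin d)}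
  {C : Fin k → EuclideanSpace ℝ (Fin d)} {A : Fin n → Fin k}

theorem SingleLinkage.isPartition {y : Fin mo → EuclideanSpace ℝ (Fin d)}
    {P : Finset (Finset (Fin mo))} (h : SingleLinkage y P) :
    (∀ S ∈ P, S.Nonempty) ∧ (∀ S ∈ P, ∀ T ∈ P, S ≠ T → Disjoint S T) ∧ ∀ i, ∃ S ∈ P, i ∈ S := by
  induction h with
  | init =>
    refine ⟨by simp, ?_, fun i => ⟨{i}, by simp, by simp⟩⟩
    simp only [Finset.mem_image, Finset.mem_univ, true_and, forall_exists_index,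
      forall_apply_eq_imp_iff]
    intro i j hij
    simpa using hij
  | merge P S T i j hP hS hT hST hi hj hmin ih =>
    obtain ⟨ne, dis, cov⟩ := ih
    have key : ∀ U ∈ (P.erase S).erase T, Disjoint (S ∪ T) U := fun U hU => by
      simp only [Finset.mem_erase] at hU
      exact Finset.disjoint_union_left.2
        ⟨dis S hS U hU.2.2 (Ne.symm hU.2.1), dis T hT U hU.2.2 (Ne.symm hU.1)⟩
    refine ⟨fun U hU => ?_, fun U hU V hV hUV => ?_, fun a => ?_⟩
    · rcases Finset.mem_insert.1 hU with rfl | hU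
      · exact ⟨i, Finset.mem_union_left _ hi⟩
      · exact ne U (Finset.mem_of_mem_erase (Finset.mem_of_mem_erase hU))
    · rcases Finset.mem_insert.1 hU with rfl | hU' <;> rcases Finset.mem_insert.1 hV with rfl | hV'
      · exact absurd rfl hUV
      · exact key V hV'
      · exact (key U hU').symm
      · exact dis U (Finset.mem_of_mem_erase (Finset.mem_of_mem_erase hU')) V
          (Finset.mem_of_mem_erase (Finset.mem_of_mem_erase hV')) hUV
    · obtain ⟨U, hU, ha⟩ := cov a
      by_cases h1 : U = S
      · exact ⟨S ∪ T, Finset.mem_insert_self _ _, Finset.mem_union_left _ (h1 ▸ ha)⟩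
      by_cases h2 : U = T
      · exact ⟨S ∪ T, Finset.mem_insert_self _ _, Finset.mem_union_right _ (h2 ▸ ha)⟩
      · exact ⟨U, Finset.mem_insert_of_mem
          (Finset.mem_erase.2 ⟨h2, Finset.mem_erase.2 ⟨h1, hU⟩⟩), ha⟩

/-- If points with the same label are always closer than points with different labels, single
linkage merges only components with the same label as long as it leaves at least as many
components as there are labels: before such a merge two of the components share a label, by the
pigeonhole principle, so the smallest distance is one between points with the same label. -/
theorem SingleLinkage.exists_label {y : Fin mo → EuclideanSpace ℝ (Fin d)} {l : Fin mo → Fin k}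
    (hl : ∀ i j i' j', l i = l j → l i' ≠ l j' → ‖y i - y j‖ < ‖y i' - y j'‖)
    {P : Finset (Finset (Fin mo))} (h : SingleLinkage y P) (hP : k ≤ P.card) :
    ∀ S ∈ P, ∃ u, ∀ i ∈ S, l i = u := by
  induction h with
  | init =>
    simp only [Finset.mem_image, Finset.mem_univ, true_and, forall_exists_index,
      forall_apply_eq_imp_iff, Finset.mem_singleton, forall_eq, exists_eq', implies_true]
  | merge P S T i j hSL hS hT hST hi hj hmin ih =>
    have hcard : k < P.card := by
      have h1 := Finset.card_insert_le (S ∪ T) ((P.erase S).erase T)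
      have h2 : T ∈ P.erase S := Finset.mem_erase.2 ⟨hST.symm, hT⟩
      have h3 := Finset.card_erase_add_one h2
      have h4 := Finset.card_erase_add_one hS
      omega
    have hlab := ih hcard.le
    obtain ⟨ne, -, -⟩ := hSL.isPartition
    have hij : l i = l j := by
      by_contra hne
      have : Nonempty (Fin k) := ⟨l i⟩
      choose! g hg using hlab
      obtain ⟨U, hU, V, hV, hUV, hgUV⟩ := Finset.exists_ne_map_eq_of_card_lt_of_maps_to
        (s := P) (t := Finset.univ) (f := g) (by simpa using hcard) (fun _ _ => by simp)
      obtain ⟨a, ha⟩ := ne U hU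
      obtain ⟨b, hb⟩ := ne V hV
      have h1 := hmin U hU V hV hUV a ha b hb
      have h2 := hl a b i j (by rw [hg U hU a ha, hg V hV b hb, hgUV]) hne
      linarith
    intro U hU
    rcases Finset.mem_insert.1 hU with rfl | hU
    · obtain ⟨u, hu⟩ := hlab S hS
      obtain ⟨v, hv⟩ := hlab T hT
      refine ⟨u, fun a ha => ?_⟩
      rcases Finset.mem_union.1 ha with ha | ha
      · exact hu a ha
      · rw [hv a ha, ← hv j hj, ← hij, hu i hi]
    · exact hlab U (Finset.mem_of_mem_erase (Finset.mem_of_mem_erase hU))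

/-- After the relabelling `σ` each centroid of `C'` is within the radius of its counterpart. -/
def CloseTo (C : Fin k → EuclideanSpace ℝ (Fin d)) (ρ : Fin k → ℝ) (σ : Equiv.Perm (Fin k))
    (C' : Fin k → EuclideanSpace ℝ (Fin d)) : Prop :=
  ∀ r, ‖C' (σ r) - C r‖ ≤ ρ r

/-- If the sample hits every cluster, Buckshot recovers the clusters of well separated data on
the sample, so that each seed is the mean of points of one cluster. -/
theorem WellSeparated.exists_closeTo_seed {ρ : Fin k → ℝ} (h : WellSeparated x C A ρ)
    {a : Fin mo → Fin n} (ha : ∀ r, ∃ i, A (a i) = r) {C0 : Fin k → EuclideanSpace ℝ (Fin d)}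
    (hC0 : IsBuckshotSeed (fun i => x (a i)) C0) : ∃ σ, CloseTo C ρ σ C0 := by
  obtain ⟨P, hP, e, he⟩ := hC0
  have hcard : P.card = k := by
    simpa using (Fintype.card_congr e).symm
  obtain ⟨ne, -, cov⟩ := hP.isPartition
  have hlab := hP.exists_label (l := fun i => A (a i)) (fun i j i' j' hij hij' => by
    refine lt_of_le_of_lt ?_ (h.point_gap (a i') (a j') (A (a i)) hij')
    have h1 := h.radius_le (a i)
    have h2 := h.radius_le (a j)
    rw [← hij, norm_sub_rev] at h2
    have := norm_sub_le_norm_sub_add_norm_sub (x (a i)) (C (A (a i))) (x (a j))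
    linarith) hcard.ge
  have hg : ∀ s, ∃ u, ∀ i ∈ (e s : Finset (Fin mo)), A (a i) = u := fun s => hlab _ (e s).2
  choose g hg using hg
  have hsurj : Function.Surjective g := fun r => by
    obtain ⟨i, hi⟩ := ha r
    obtain ⟨S, hS, hiS⟩ := cov i
    refine ⟨e.symm ⟨S, hS⟩, ?_⟩
    rw [← hg _ i (by simpa using hiS), hi]
  let π := Equiv.ofBijective g (Finite.surjective_iff_bijective.1 hsurj)
  refine ⟨π.symm, fun r => ?_⟩
  rw [he]
  refine norm_mean_sub_le _ (ne _ (e _).2) _ (h.radius_nonneg r) fun i hi => ?_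
  have h1 : A (a i) = r := by
    rw [hg _ i hi]; exact π.apply_symm_apply r
  rw [← h1]
  exact h.radius_le _

/-! ### One iteration on well separated data -/

/-- The points of the batch `b` that belong to the cluster `r`. -/
def hits {m : ℕ} (A : Fin n → Fin k) (b : Fin m → Fin n) (r : Fin k) : Finset (Fin m) :=
  Finset.univ.filter fun j => A (b j) = r

theorem WellSeparated.near_eq {ρ : Fin k → ℝ} (h : WellSeparated x C A ρ)
    {near : (Fin k → EuclideanSpace ℝ (Fin d)) → EuclideanSpace ℝ (Fin d) → Fin k}
    (hnear : IsNearestRule near) {σ : Equiv.Perm (Fin k)}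
    {C' : Fin k → EuclideanSpace ℝ (Fin d)} (hC' : CloseTo C ρ σ C') (i : Fin n) :
    near C' (x i) = σ (A i) := by
  by_contra hne
  obtain ⟨s, hs⟩ := σ.surjective (near C' (x i))
  have hAs : A i ≠ s := fun hh => hne (by rw [← hs, hh])
  have h1 := hnear C' (x i) (σ (A i))
  rw [← hs] at h1
  have h2 := h.center_gap i s hAs
  have h3 := h.radius_le i
  have h4 := hC' (A i)
  have h5 := hC' s
  have h6 := norm_sub_le_norm_sub_add_norm_sub (x i) (C' (σ s)) (C s)
  have h7 := norm_sub_le_norm_sub_add_norm_sub (x i) (C (A i)) (C' (σ (A i)))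
  rw [norm_sub_rev (C (A i))] at h7
  linarith

theorem WellSeparated.step_apply {m : ℕ} {ρ : Fin k → ℝ} (h : WellSeparated x C A ρ)
    {near : (Fin k → EuclideanSpace ℝ (Fin d)) → EuclideanSpace ℝ (Fin d) → Fin k}
    (hnear : IsNearestRule near) {σ : Equiv.Perm (Fin k)}
    {C' : Fin k → EuclideanSpace ℝ (Fin d)} (hC' : CloseTo C ρ σ C') (η : ℝ) (b : Fin m → Fin n)
    (r : Fin k) :
    step near η C' (fun j => x (b j)) (σ r) =
      if (hits A b r).Nonempty then
        (1 - η) • C' (σ r) + η • mean (fun j => x (b j)) (hits A b r)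
      else C' (σ r) := by
  have h1 : (Finset.univ.filter fun j => near C' (x (b j)) = σ r) = hits A b r := by
    ext j
    simp [hits, h.near_eq hnear hC']
  simp only [step, h1]

theorem WellSeparated.closeTo_step {m : ℕ} {ρ : Fin k → ℝ} (h : WellSeparated x C A ρ)
    {near : (Fin k → EuclideanSpace ℝ (Fin d)) → EuclideanSpace ℝ (Fin d) → Fin k}
    (hnear : IsNearestRule near) {σ : Equiv.Perm (Fin k)}
    {C' : Fin k → EuclideanSpace ℝ (Fin d)} (hC' : CloseTo C ρ σ C') {η : ℝ} (h0 : 0 ≤ η)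
    (h1 : η ≤ 1) (b : Fin m → Fin n) :
    CloseTo C ρ σ (step near η C' fun j => x (b j)) := fun r => by
  rw [h.step_apply hnear hC']
  split_ifs with hne
  · have hmem : mean (fun j => x (b j)) (hits A b r) ∈ Metric.closedBall (C r) (ρ r) := by
      rw [mem_closedBall_iff_norm]
      refine norm_mean_sub_le _ hne _ (h.radius_nonneg r) fun j hj => ?_
      rw [← (Finset.mem_filter.1 hj).2]
      exact h.radius_le _
    rw [← mem_closedBall_iff_norm]
    exact convex_closedBall _ _ (mem_closedBall_iff_norm.2 (hC' r)) hmem (by linarith) h0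
      (by ring)
  · exact hC' r

theorem WellSeparated.closeTo_run {m : ℕ} {ρ : Fin k → ℝ} (h : WellSeparated x C A ρ)
    {near : (Fin k → EuclideanSpace ℝ (Fin d)) → EuclideanSpace ℝ (Fin d) → Fin k}
    (hnear : IsNearestRule near) {σ : Equiv.Perm (Fin k)}
    {C0 : Fin k → EuclideanSpace ℝ (Fin d)} (hC0 : CloseTo C ρ σ C0) {η : ℕ → ℝ}
    (h0 : ∀ t, 0 ≤ η (t + 1)) (h1 : ∀ t, η (t + 1) ≤ 1) (b : ℕ → Fin m → Fin n) (t : ℕ) :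
    CloseTo C ρ σ (run near η C0 (fun t j => x (b t j)) t) := by
  induction t with
  | zero => exact hC0
  | succ t ih => exact h.closeTo_step hnear ih (h0 t) (h1 t) (b t)

end Linkage

/-! ### Averages over all batches -/

section Batch

variable {d n k m : ℕ} {x : Fin n → EuclideanSpace ℝ (Fin d)}
  {C : Fin k → EuclideanSpace ℝ (Fin d)} {A : Fin n → Fin k}

/-- The deviation from the centroid `C r` of the mean of those points of the batch that belong to
the cluster `r`; it is `0` if there are none. -/
noncomputable def batchDev (x : Fin n → EuclideanSpace ℝ (Fin d)) (C : Fin k → EuclideanSpace ℝ (Fin d))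
    (A : Fin n → Fin k) (b : Fin m → Fin n) (r : Fin k) : EuclideanSpace ℝ (Fin d) :=
  ((hits A b r).card : ℝ)⁻¹ • ∑ j ∈ hits A b r, (x (b j) - C r)

/-- The batch mean of a cluster is an unbiased estimate of its centroid: redrawing the `j`-th
point of the batch within the cluster does not change the number of hits, and the average of
such points is the centroid. -/
theorem IsStationary.sum_batchDev (h : IsStationary x C A) (r : Fin k) :
    ∑ b : Fin m → Fin n, batchDev x C A b r = 0 := by
  have h1 : ∀ b : Fin m → Fin n, batchDev x C A b r =
      ∑ j, if A (b j) = r then ((hits A b r).card : ℝ)⁻¹ • (x (b j) - C r) else 0 := fun b => by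
    rw [batchDev, Finset.smul_sum, ← Finset.sum_filter]; rfl
  simp_rw [h1]
  rw [Finset.sum_comm]
  refine Finset.sum_eq_zero fun j _ => ?_
  rw [← (Equiv.funSplitAt j (Fin n)).symm.sum_comp, Fintype.sum_prod_type_right]
  refine Finset.sum_eq_zero fun b' _ => ?_
  have hj : ∀ i, (Equiv.funSplitAt j (Fin n)).symm (i, b') j = i := fun i => by simp
  obtain ⟨i₀, hi₀⟩ := h.nonempty r
  rw [mem_cluster] at hi₀
  have hhits : ∀ i, A i = r → hits A ((Equiv.funSplitAt j (Fin n)).symm (i, b')) r =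
      hits A ((Equiv.funSplitAt j (Fin n)).symm (i₀, b')) r := fun i hi => by
    ext j'
    by_cases hjj : j' = j
    · subst hjj; simp [hits, hi, hi₀]
    · simp [hits, hjj]
  calc _ = ∑ i, if A i = r then
        ((hits A ((Equiv.funSplitAt j (Fin n)).symm (i₀, b')) r).card : ℝ)⁻¹ • (x i - C r)
        else 0 := by
        refine Finset.sum_congr rfl fun i _ => ?_
        rw [hj]
        split_ifs with hi
        · rw [hhits i hi]
        · rfl
    _ = 0 := by
        rw [← Finset.sum_filter, ← Finset.smul_sum]
        exact (congrArg _ (h.sum_sub_eq_zero r)).trans (smul_zero _)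

/-- The number of batches that miss a given cluster. -/
theorem card_hits_eq_empty_le {p : ℝ} (r : Fin k) (hp : p ≤ (size A r : ℝ) / n) :
    ((Finset.univ.filter fun b : Fin m → Fin n => ¬(hits A b r).Nonempty).card : ℝ) ≤
      (n : ℝ) ^ m * Real.exp (-(m * p)) := by
  have h1 : (Finset.univ.filter fun b : Fin m → Fin n => ¬(hits A b r).Nonempty) =
      Fintype.piFinset fun _ => (cluster A r)ᶜ := by
    ext b
    simp [hits, cluster, Finset.filter_eq_empty_iff]
  rw [h1, Fintype.card_piFinset_const, Finset.card_compl, Fintype.card_fin, Nat.cast_pow,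
    Nat.cast_sub (by simpa using Finset.card_le_univ (cluster A r)), neg_mul_eq_mul_neg,
    Real.exp_nat_mul, ← mul_pow]
  have h2 : ((cluster A r).card : ℝ) ≤ n := by
    exact_mod_cast (by simpa using Finset.card_le_univ (cluster A r))
  refine pow_le_pow_left₀ (by linarith) ?_ m
  rcases Nat.eq_zero_or_pos n with hn | hn
  · subst hn
    simp
  have hn' : (0 : ℝ) < n := by exact_mod_cast hn
  rw [le_div_iff₀ hn'] at hp
  have h3 := Real.one_sub_le_exp_neg p
  have : (n : ℝ) * (1 - p) ≤ n * Real.exp (-p) := by gcongr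
  simp only [size] at hp
  linarith

/-- One step of the stochastic approximation: with a learning rate `η`, the squared distance to
the centroid contracts by the factor `1 - q η` on average over all batches, up to an error
`η² ρ²`, where `q` is a lower bound for the proportion of batches that hit the cluster. -/
theorem WellSeparated.sum_step_le {ρ : Fin k → ℝ} (h : WellSeparated x C A ρ)
    (hst : IsStationary x C A)
    {near : (Fin k → EuclideanSpace ℝ (Fin d)) → EuclideanSpace ℝ (Fin d) → Fin k}
    (hnear : IsNearestRule near) {σ : Equiv.Perm (Fin k)}
    {C' : Fin k → EuclideanSpace ℝ (Fin d)} (hC' : CloseTo C ρ σ C') {η q : ℝ} (h0 : 0 ≤ η)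
    (h1 : η ≤ 1) (r : Fin k)
    (hq : ((Finset.univ.filter fun b : Fin m → Fin n => ¬(hits A b r).Nonempty).card : ℝ) ≤
      (n : ℝ) ^ m * (1 - q)) :
    ∑ b : Fin m → Fin n, ‖step near η C' (fun j => x (b j)) (σ r) - C r‖ ^ 2 ≤
      (n : ℝ) ^ m * ((1 - q * η) * ‖C' (σ r) - C r‖ ^ 2 + η ^ 2 * ρ r ^ 2) := by
  set v := C' (σ r) - C r with hv
  have hpt : ∀ b : Fin m → Fin n, ‖step near η C' (fun j => x (b j)) (σ r) - C r‖ ^ 2 ≤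
      (1 - η) * ‖v‖ ^ 2 + (if ¬(hits A b r).Nonempty then η * ‖v‖ ^ 2 else 0) +
        2 * (η * (1 - η)) * inner ℝ v (batchDev x C A b r) + η ^ 2 * ρ r ^ 2 := fun b => by
    have hdev : ‖batchDev x C A b r‖ ≤ ρ r :=
      norm_smul_sum_sub_le (fun j => x (b j)) _ _ (h.radius_nonneg r) fun j hj => by
        rw [← (Finset.mem_filter.1 hj).2]
        exact h.radius_le _
    rw [h.step_apply hnear hC']
    by_cases hne : (hits A b r).Nonempty
    · simp only [hne, if_true, not_true_eq_false, if_false]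
      have e : (1 - η) • C' (σ r) + η • mean (fun j => x (b j)) (hits A b r) - C r =
          (1 - η) • v + η • batchDev x C A b r := by
        rw [batchDev, ← mean_sub (fun j => x (b j)) hne (C r), hv]
        module
      rw [e, norm_add_sq_real, norm_smul, norm_smul, inner_smul_left, inner_smul_right, mul_pow,
        mul_pow]
      simp only [Real.norm_eq_abs, sq_abs, conj_trivial]
      have h2 : η ^ 2 * ‖batchDev x C A b r‖ ^ 2 ≤ η ^ 2 * ρ r ^ 2 := by gcongr
      have h3 : (1 - η) ^ 2 * ‖v‖ ^ 2 ≤ (1 - η) * ‖v‖ ^ 2 := by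
        gcongr; nlinarith
      nlinarith
    · have hz : batchDev x C A b r = 0 := by
        rw [batchDev, Finset.not_nonempty_iff_eq_empty.1 hne, Finset.sum_empty, smul_zero]
      simp only [hne, if_false, not_false_eq_true, if_true, hz, inner_zero_right, ← hv]
      nlinarith [sq_nonneg (η * ρ r)]
  refine (Finset.sum_le_sum fun b _ => hpt b).trans ?_
  have hcross : ∑ b : Fin m → Fin n, 2 * (η * (1 - η)) * inner ℝ v (batchDev x C A b r) = 0 := by
    rw [← Finset.mul_sum, ← inner_sum, hst.sum_batchDev, inner_zero_right, mul_zero]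
  rw [Finset.sum_add_distrib, Finset.sum_add_distrib, Finset.sum_add_distrib, hcross,
    ← Finset.sum_filter]
  simp only [Finset.sum_const, nsmul_eq_mul, Finset.card_univ, Fintype.card_fun, Fintype.card_fin,
    Nat.cast_pow]
  have h4 := mul_le_mul_of_nonneg_right hq (by positivity : 0 ≤ η * ‖v‖ ^ 2)
  linarith

end Batch

/-! ### Uniform independent samples -/

section Sampling

variable {Ω : Type*} [MeasurableSpace Ω] {μ : Measure Ω}
  {n mo m : ℕ} {ν : Fin mo → Ω → Fin n} {S : ℕ → Fin m → Ω → Fin n}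

/-- A sample of independent uniform draws takes every value with the same probability. -/
theorem real_map_singleton_of_uniform [IsProbabilityMeasure μ] {l : ℕ} {X : Fin l → Ω → Fin n}
    (hX : ∀ i, Measurable (X i)) (hlaw : ∀ i, μ.map (X i) = uniformOn Set.univ)
    (hind : iIndepFun X μ) (b : Fin l → Fin n) :
    (μ.map fun ω i => X i ω).real {b} = ((n : ℝ) ^ l)⁻¹ := by
  rw [(iIndepFun_iff_map_fun_eq_pi_map fun i => (hX i).aemeasurable).1 hind, measureReal_def,
    ← Set.univ_pi_singleton, Measure.pi_pi]
  simp [hlaw, uniformOn_univ]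

theorem IsUniformSampling.real_map_seed [IsProbabilityMeasure μ] (h : IsUniformSampling μ ν S) (b : Fin mo → Fin n) :
    (μ.map fun ω i => ν i ω).real {b} = ((n : ℝ) ^ mo)⁻¹ :=
  real_map_singleton_of_uniform h.measurable_seed h.law_seed
    (h.indep.precomp (g := Sum.inl) Sum.inl_injective) b

theorem IsUniformSampling.real_map_batch [IsProbabilityMeasure μ] (h : IsUniformSampling μ ν S) (t : ℕ)
    (b : Fin m → Fin n) : (μ.map fun ω j => S t j ω).real {b} = ((n : ℝ) ^ m)⁻¹ :=
  real_map_singleton_of_uniform (h.measurable_batch t) (h.law_batch t)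
    (h.indep.precomp (g := fun j => Sum.inr (t, j)) fun i j hij => by simpa using hij) b

/-- The seeding sample and the first `t` batches. -/
def past (ν : Fin mo → Ω → Fin n) (S : ℕ → Fin m → Ω → Fin n) (t : ℕ) (ω : Ω) :
    (Fin mo → Fin n) × (Fin t → Fin m → Fin n) :=
  (fun i => ν i ω, fun s j => S s j ω)

theorem IsUniformSampling.measurable_past (h : IsUniformSampling μ ν S) (t : ℕ) :
    Measurable (past ν S t) :=
  (measurable_pi_lambda _ h.measurable_seed).prodMk
    (measurable_pi_lambda _ fun s => measurable_pi_lambda _ (h.measurable_batch s))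

theorem IsUniformSampling.indepFun_past [IsProbabilityMeasure μ] (h : IsUniformSampling μ ν S) (t : ℕ) :
    IndepFun (past ν S t) (fun ω j => S t j ω) μ := by
  let I : Finset (Fin mo ⊕ (ℕ × Fin m)) :=
    Finset.disjSum Finset.univ (Finset.range t ×ˢ Finset.univ)
  let J : Finset (Fin mo ⊕ (ℕ × Fin m)) := Finset.disjSum ∅ ({t} ×ˢ Finset.univ)
  have hIJ : Disjoint I J := by
    rw [Finset.disjoint_left]
    rintro (i | ⟨s, j⟩) hi hj
    · simp [J] at hj
    · simp [I] at hi
      simp [J] at hj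
      omega
  have hmeas : ∀ q, Measurable (fun ω => Sum.elim ν (fun p : ℕ × Fin m => S p.1 p.2) q ω) := by
    rintro (i | ⟨s, j⟩)
    · exact h.measurable_seed i
    · exact h.measurable_batch s j
  have hind := h.indep.indepFun_finset I J hIJ hmeas
  exact hind.comp
    (φ := fun g : I → Fin n => ((fun i => g ⟨Sum.inl i, by simp [I]⟩,
      fun s j => g ⟨Sum.inr (s, j), by simp [I]⟩) :
        (Fin mo → Fin n) × (Fin t → Fin m → Fin n)))
    (ψ := fun (g : J → Fin n) (j : Fin m) => g ⟨Sum.inr (t, j), by simp [J]⟩)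
    Measurable.of_discrete Measurable.of_discrete

/-- Averaging over an independent uniformly distributed variable `B` first. -/
theorem integral_eq_integral_average [IsProbabilityMeasure μ] {Z W : Type*} [Finite Z] [MeasurableSpace Z]
    [DiscreteMeasurableSpace Z] [Fintype W] [MeasurableSpace W] [DiscreteMeasurableSpace W]
    {ζ : Ω → Z} {B : Ω → W} (hζ : Measurable ζ) (hB : Measurable B) (hind : IndepFun ζ B μ)
    {p : ℝ} (hp : ∀ b, (μ.map B).real {b} = p) (g : Z → W → ℝ) :
    ∫ ω, g (ζ ω) (B ω) ∂μ = ∫ ω, p * ∑ b, g (ζ ω) b ∂μ := by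
  have h1 := (indepFun_iff_map_prod_eq_prod_map_map hζ.aemeasurable hB.aemeasurable).1 hind
  have : IsProbabilityMeasure (μ.map ζ) := Measure.isProbabilityMeasure_map hζ.aemeasurable
  have : IsProbabilityMeasure (μ.map B) := Measure.isProbabilityMeasure_map hB.aemeasurable
  calc ∫ ω, g (ζ ω) (B ω) ∂μ = ∫ z, g z.1 z.2 ∂(μ.map fun ω => (ζ ω, B ω)) :=
        (integral_map (hζ.prodMk hB).aemeasurable
          (Measurable.of_discrete (f := fun z : Z × W => g z.1 z.2)).aestronglyMeasurable).symm
    _ = ∫ z, ∫ b, g z b ∂(μ.map B) ∂(μ.map ζ) := by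
        rw [h1, integral_prod _ .of_finite]
    _ = ∫ z, p * ∑ b, g z b ∂(μ.map ζ) := by
        congr 1
        ext z
        rw [integral_fintype .of_finite, Finset.mul_sum]
        simp_rw [hp, smul_eq_mul]
    _ = _ := integral_map hζ.aemeasurable
          (Measurable.of_discrete (f := fun z : Z => p * ∑ b, g z b)).aestronglyMeasurable

theorem integrable_comp_of_finite {Z : Type*} [Finite Z] [MeasurableSpace Z]
    [DiscreteMeasurableSpace Z] {P : Measure Ω} [IsFiniteMeasure P] {ζ : Ω → Z}
    (hζ : Measurable ζ) (g : Z → ℝ) : Integrable (fun ω => g (ζ ω)) P :=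
  (Integrable.of_finite (μ := P.map ζ) (f := g)).comp_measurable hζ

/-- The seeding sample hits every cluster. -/
def seedHits {k : ℕ} (A : Fin n → Fin k) (ν : Fin mo → Ω → Fin n) : Set Ω :=
  {ω | ∀ r, ∃ i, A (ν i ω) = r}

theorem IsUniformSampling.measurableSet_seedHits {k : ℕ} (h : IsUniformSampling μ ν S)
    (A : Fin n → Fin k) : MeasurableSet (seedHits A ν) :=
  (measurable_pi_lambda (fun ω i => ν i ω) h.measurable_seed)
    (MeasurableSet.of_discrete (s := {a : Fin mo → Fin n | ∀ r, ∃ i, A (a i) = r}))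

/-- The union bound over the clusters that the seeding sample may miss. -/
theorem IsUniformSampling.le_real_seedHits [IsProbabilityMeasure μ] {k : ℕ} (h : IsUniformSampling μ ν S) (hn : 0 < n)
    (A : Fin n → Fin k) : 1 - k * Real.exp (-(mo * pMin A)) ≤ μ.real (seedHits A ν) := by
  have hmeas : Measurable fun ω i => ν i ω := measurable_pi_lambda _ h.measurable_seed
  have hn' : (0 : ℝ) < n := by exact_mod_cast hn
  have hmiss : ∀ r, μ.real {ω | ¬(hits A (fun i => ν i ω) r).Nonempty} ≤
      Real.exp (-(mo * pMin A)) := fun r => by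
    have e : μ.real {ω | ¬(hits A (fun i => ν i ω) r).Nonempty} = (μ.map fun ω i => ν i ω).real
        ((Finset.univ.filter fun b : Fin mo → Fin n => ¬(hits A b r).Nonempty : Finset _) :
          Set (Fin mo → Fin n)) := by
      rw [map_measureReal_apply hmeas .of_discrete]
      congr 1
      ext ω
      simp
    rw [e, ← sum_measureReal_singleton]
    simp_rw [h.real_map_seed]
    rw [Finset.sum_const, nsmul_eq_mul, ← div_eq_mul_inv, div_le_iff₀ (by positivity), mul_comm]
    exact card_hits_eq_empty_le r (pMin_le r)
  have hcompl : (seedHits A ν)ᶜ ⊆ ⋃ r, {ω | ¬(hits A (fun i => ν i ω) r).Nonempty} := by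
    intro ω hω
    simp only [seedHits, Set.mem_compl_iff, Set.mem_ofPred_eq, not_forall] at hω
    obtain ⟨r, hr⟩ := hω
    refine Set.mem_iUnion.2 ⟨r, fun ⟨j, hj⟩ => hr ⟨j, (Finset.mem_filter.1 hj).2⟩⟩
  have h1 := (measureReal_mono (μ := μ) hcompl).trans (measureReal_iUnion_fintype_le _)
  have h2 := h1.trans (Finset.sum_le_sum fun r _ => hmiss r)
  rw [probReal_compl_eq_one_sub (h.measurableSet_seedHits A)] at h2
  simp only [Finset.sum_const, Finset.card_univ, Fintype.card_fin, nsmul_eq_mul] at h2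
  linarith

end Sampling

/-! ### The rate of the stochastic approximation -/

/-- The recursion of stochastic approximation with the learning rate `c / (t + s)`: a contraction
constant `q` with `q c > 1` makes the error decay like `1 / t`. -/
theorem exists_le_div_of_recursion {u : ℕ → ℝ} {q c s W : ℝ} (hs : 0 < s) (hqc : 1 < q * c)
    (hqs : q * c ≤ s) (hW : 0 ≤ W)
    (h : ∀ t : ℕ, u (t + 1) ≤ (1 - q * (c / (((t + 1 : ℕ) : ℝ) + s))) * u t +
      (c / (((t + 1 : ℕ) : ℝ) + s)) ^ 2 * W) :
    ∃ K, 0 ≤ K ∧ ∀ t : ℕ, u t ≤ K / (t + s) := by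
  have hpos : 0 < q * c - 1 := by linarith
  refine ⟨max (u 0 * s) (c ^ 2 * W / (q * c - 1)), le_max_of_le_right (by positivity),
    fun t => ?_⟩
  set K := max (u 0 * s) (c ^ 2 * W / (q * c - 1)) with hK
  have hK1 : c ^ 2 * W ≤ K * (q * c - 1) := by
    rw [← div_le_iff₀ hpos]; exact le_max_right _ _
  induction t with
  | zero =>
    rw [Nat.cast_zero, zero_add, le_div_iff₀ hs]
    exact le_max_left _ _
  | succ t ih =>
    have hy : 0 < (t : ℝ) + s := by positivity
    have hz : 0 < (t : ℝ) + 1 + s := by linarith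
    have hc : 0 ≤ 1 - q * (c / (t + 1 + s)) := by
      rw [sub_nonneg, mul_div_assoc', div_le_one hz]
      have : (0 : ℝ) ≤ t := t.cast_nonneg
      linarith
    have hKnn : 0 ≤ K * (q * c - 1) := le_trans (by positivity) hK1
    have h1 := h t
    push_cast at h1 ⊢
    refine h1.trans ((add_le_add (mul_le_mul_of_nonneg_left ih hc) le_rfl).trans ?_)
    have e : K / (t + 1 + s) - ((1 - q * (c / (t + 1 + s))) * (K / (t + s)) +
        (c / (t + 1 + s)) ^ 2 * W) =
        (K * (q * c - 1) * (t + 1 + s) - c ^ 2 * W * (t + s)) / ((t + s) * (t + 1 + s) ^ 2) := by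
      field_simp
      ring
    rw [← sub_nonneg, e]
    refine div_nonneg ?_ (by positivity)
    nlinarith

section Convergence

variable {Ω : Type*} {d n k mo m : ℕ} {x : Fin n → EuclideanSpace ℝ (Fin d)}
  {C : Fin k → EuclideanSpace ℝ (Fin d)} {A : Fin n → Fin k}
  {seed : (Fin mo → EuclideanSpace ℝ (Fin d)) → Fin k → EuclideanSpace ℝ (Fin d)}
  {near : (Fin k → EuclideanSpace ℝ (Fin d)) → EuclideanSpace ℝ (Fin d) → Fin k}
  {ν : Fin mo → Ω → Fin n} {S : ℕ → Fin m → Ω → Fin n}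

theorem run_congr {η : ℕ → ℝ} {C0 : Fin k → EuclideanSpace ℝ (Fin d)}
    {b b' : ℕ → Fin m → EuclideanSpace ℝ (Fin d)} {t : ℕ} (h : ∀ s < t, b s = b' s) :
    run near η C0 b t = run near η C0 b' t := by
  induction t with
  | zero => rfl
  | succ t ih => rw [run, run, ih fun s hs => h s (by omega), h t (by omega)]

/-- The iterate `C^t` as a function of the seeding sample and the first `t` batches. -/
noncomputable def iterateOf (x : Fin n → EuclideanSpace ℝ (Fin d))
    (seed : (Fin mo → EuclideanSpace ℝ (Fin d)) → Fin k → EuclideanSpace ℝ (Fin d))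
    (near : (Fin k → EuclideanSpace ℝ (Fin d)) → EuclideanSpace ℝ (Fin d) → Fin k)
    (c' t_o : ℝ) {t : ℕ} (z : (Fin mo → Fin n) × (Fin t → Fin m → Fin n)) :
    Fin k → EuclideanSpace ℝ (Fin d) :=
  run near (fun t : ℕ => c' / ((t : ℝ) + t_o)) (seed fun i => x (z.1 i))
    (fun s j => if hs : s < t then x (z.2 ⟨s, hs⟩ j) else 0) t

theorem iterate_eq_iterateOf (c' t_o : ℝ) (t : ℕ) (ω : Ω) :
    iterate x seed near c' t_o ν S t ω = iterateOf x seed near c' t_o (past ν S t ω) := by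
  refine run_congr fun s hs => ?_
  simp [past, hs]

/-- The weighted squared distance from `C'` to `C` after the relabelling `σ a`, set to `0` if the
seeding sample `a` misses a cluster. -/
noncomputable def seededDist (C : Fin k → EuclideanSpace ℝ (Fin d)) (A : Fin n → Fin k)
    (σ : (Fin mo → Fin n) → Equiv.Perm (Fin k)) (a : Fin mo → Fin n)
    (C' : Fin k → EuclideanSpace ℝ (Fin d)) : ℝ :=
  if ∀ r, ∃ i, A (a i) = r then ∑ r, (size A r : ℝ) * ‖C' (σ a r) - C r‖ ^ 2 else 0

theorem seededDist_nonneg (σ : (Fin mo → Fin n) → Equiv.Perm (Fin k)) (a : Fin mo → Fin n)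
    (C' : Fin k → EuclideanSpace ℝ (Fin d)) : 0 ≤ seededDist C A σ a C' := by
  rw [seededDist]
  split_ifs
  · exact Finset.sum_nonneg fun _ _ => by positivity
  · exact le_rfl

theorem centroidalDist_le_seededDist (σ : (Fin mo → Fin n) → Equiv.Perm (Fin k)) {ω : Ω}
    (hω : ω ∈ seedHits A ν) (C' : Fin k → EuclideanSpace ℝ (Fin d)) :
    centroidalDist A C' C ≤ seededDist C A σ (fun i => ν i ω) C' := by
  have hω' : ∀ r, ∃ i, A (ν i ω) = r := hω
  rw [seededDist, if_pos hω']
  exact centroidalDist_le C' _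

variable [MeasurableSpace Ω] {μ : Measure Ω}

theorem IsUniformSampling.integrable_iterate (h : IsUniformSampling μ ν S) {P : Measure Ω}
    [IsFiniteMeasure P] (c' t_o : ℝ) (t : ℕ)
    (g : (Fin k → EuclideanSpace ℝ (Fin d)) → ℝ) :
    Integrable (fun ω => g (iterate x seed near c' t_o ν S t ω)) P := by
  simp_rw [iterate_eq_iterateOf]
  exact integrable_comp_of_finite (h.measurable_past t) fun z => g (iterateOf x seed near c' t_o z)

theorem IsUniformSampling.integrable_seededDist (h : IsUniformSampling μ ν S) {P : Measure Ω}
    [IsFiniteMeasure P] (c' t_o : ℝ) (t : ℕ) (σ : (Fin mo → Fin n) → Equiv.Perm (Fin k)) :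
    Integrable (fun ω => seededDist C A σ (fun i => ν i ω)
      (iterate x seed near c' t_o ν S t ω)) P := by
  simp_rw [iterate_eq_iterateOf]
  exact integrable_comp_of_finite (h.measurable_past t)
    fun z => seededDist C A σ z.1 (iterateOf x seed near c' t_o z)

/-- The recursion for the mean squared distance to the stationary point on the event that the
seeding sample hits every cluster. -/
theorem IsUniformSampling.integral_seededDist_succ_le [IsProbabilityMeasure μ]
    (h : IsUniformSampling μ ν S) {ρ : Fin k → ℝ}
    (hsep : WellSeparated x C A ρ) (hst : IsStationary x C A) (hn : 0 < n)
    (hnear : IsNearestRule near) {c' t_o q : ℝ} (hc' : 0 ≤ c') (ht_o : c' ≤ t_o) (hto0 : 0 < t_o)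
    (hq : Real.exp (-(m * pMin A)) ≤ 1 - q) {σ : (Fin mo → Fin n) → Equiv.Perm (Fin k)}
    (hσ : ∀ a : Fin mo → Fin n, (∀ r, ∃ i, A (a i) = r) →
      CloseTo C ρ (σ a) (seed fun i => x (a i))) (t : ℕ) :
    ∫ ω, seededDist C A σ (fun i => ν i ω) (iterate x seed near c' t_o ν S (t + 1) ω) ∂μ ≤
      (1 - q * (c' / (((t + 1 : ℕ) : ℝ) + t_o))) *
        ∫ ω, seededDist C A σ (fun i => ν i ω) (iterate x seed near c' t_o ν S t ω) ∂μ +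
      (c' / (((t + 1 : ℕ) : ℝ) + t_o)) ^ 2 * ∑ r, (size A r : ℝ) * ρ r ^ 2 := by
  have hη : ∀ t : ℕ, 0 ≤ c' / (((t + 1 : ℕ) : ℝ) + t_o) ∧
      c' / (((t + 1 : ℕ) : ℝ) + t_o) ≤ 1 := fun t => by
    have h1 : (0 : ℝ) ≤ ((t + 1 : ℕ) : ℝ) := Nat.cast_nonneg _
    exact ⟨by positivity, (div_le_one (by positivity)).2 (by linarith)⟩
  have hn' : (0 : ℝ) < n := by exact_mod_cast hn
  set η := c' / (((t + 1 : ℕ) : ℝ) + t_o) with hηdef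
  let g : ((Fin mo → Fin n) × (Fin t → Fin m → Fin n)) → (Fin m → Fin n) → ℝ := fun z b =>
    seededDist C A σ z.1 (step near η (iterateOf x seed near c' t_o z) fun j => x (b j))
  have e : ∀ ω, seededDist C A σ (fun i => ν i ω) (iterate x seed near c' t_o ν S (t + 1) ω) =
      g (past ν S t ω) fun j => S t j ω := fun ω => by
    simp only [g]
    rw [← iterate_eq_iterateOf]
    rfl
  simp_rw [e]
  rw [integral_eq_integral_average (h.measurable_past t)
    (measurable_pi_lambda _ (h.measurable_batch t)) (h.indepFun_past t) (h.real_map_batch t) g]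
  have hW : 0 ≤ ∑ r, (size A r : ℝ) * ρ r ^ 2 := Finset.sum_nonneg fun _ _ => by positivity
  have hpt : ∀ ω, ((n : ℝ) ^ m)⁻¹ * ∑ b, g (past ν S t ω) b ≤
      (1 - q * η) * seededDist C A σ (fun i => ν i ω) (iterate x seed near c' t_o ν S t ω) +
        η ^ 2 * ∑ r, (size A r : ℝ) * ρ r ^ 2 := fun ω => by
    rw [inv_mul_le_iff₀ (by positivity)]
    have e' : ∀ b, g (past ν S t ω) b = seededDist C A σ (fun i => ν i ω)
        (step near η (iterate x seed near c' t_o ν S t ω) fun j => x (b j)) := fun b => by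
      simp only [g]
      rw [← iterate_eq_iterateOf]
      rfl
    simp_rw [e', seededDist]
    split_ifs with hω
    · rw [Finset.sum_comm, Finset.mul_sum, Finset.mul_sum, ← Finset.sum_add_distrib,
        Finset.mul_sum]
      refine Finset.sum_le_sum fun r _ => ?_
      have hclose : CloseTo C ρ (σ fun i => ν i ω) (iterate x seed near c' t_o ν S t ω) :=
        hsep.closeTo_run hnear (hσ _ hω) (fun t => (hη t).1) (fun t => (hη t).2)
          (fun t j => S t j ω) t
      have h1 := hsep.sum_step_le hst hnear hclose (hη t).1 (hη t).2 r
        ((card_hits_eq_empty_le r (pMin_le r)).trans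
          (mul_le_mul_of_nonneg_left hq (by positivity)))
      rw [← Finset.mul_sum]
      refine (mul_le_mul_of_nonneg_left h1 (Nat.cast_nonneg _)).trans_eq ?_
      ring
    · simp only [Finset.sum_const_zero, mul_zero, zero_add]
      positivity
  have hint := h.integrable_seededDist (C := C) (A := A) (x := x) (seed := seed) (near := near)
    (P := μ) c' t_o t σ
  refine (integral_mono (integrable_comp_of_finite (h.measurable_past t) fun z =>
    ((n : ℝ) ^ m)⁻¹ * ∑ b, g z b) ((hint.const_mul _).add (integrable_const _)) hpt).trans_eq ?_
  rw [integral_add' (hint.const_mul _) (integrable_const _), integral_const_mul, integral_const]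
  simp

theorem IsUniformSampling.integral_cond_le [IsProbabilityMeasure μ] (h : IsUniformSampling μ ν S)
    (c' t_o : ℝ) (t : ℕ) (σ : (Fin mo → Fin n) → Equiv.Perm (Fin k)) :
    ∫ ω, centroidalDist A (iterate x seed near c' t_o ν S t ω) C ∂(μ[|seedHits A ν]) ≤
      (μ.real (seedHits A ν))⁻¹ *
        ∫ ω, seededDist C A σ (fun i => ν i ω) (iterate x seed near c' t_o ν S t ω) ∂μ := by
  rw [ProbabilityTheory.cond, integral_smul_measure, ENNReal.toReal_inv, smul_eq_mul]
  refine mul_le_mul_of_nonneg_left ?_ (by positivity)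
  refine (setIntegral_mono_on
    (h.integrable_iterate c' t_o t fun C' => centroidalDist A C' C)
    (h.integrable_seededDist c' t_o t σ) (h.measurableSet_seedHits A) fun ω hω =>
      centroidalDist_le_seededDist σ hω _).trans ?_
  exact setIntegral_le_integral (h.integrable_seededDist c' t_o t σ)
    (Eventually.of_forall fun ω => seededDist_nonneg _ _ _)

/-- Given that the seeding sample hits every cluster, the mean centroidal distance of the iterates
to a well separated stationary point decays like `1 / t`. -/
theorem IsUniformSampling.exists_integral_centroidalDist_le [IsProbabilityMeasure μ]
    (h : IsUniformSampling μ ν S) {ρ : Fin k → ℝ}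
    (hsep : WellSeparated x C A ρ) (hst : IsStationary x C A) (hn : 0 < n)
    (hseed : ∀ y, IsBuckshotSeed y (seed y)) (hnear : IsNearestRule near) {c' t_o q : ℝ}
    (hc' : 0 ≤ c') (ht_o : c' ≤ t_o) (hto0 : 0 < t_o) (hqc : 1 < q * c')
    (hq : Real.exp (-(m * pMin A)) ≤ 1 - q) :
    ∃ K, 0 ≤ K ∧ ∀ t : ℕ,
      ∫ ω, centroidalDist A (iterate x seed near c' t_o ν S t ω) C ∂(μ[|seedHits A ν]) ≤
        K / (t + t_o) := by
  have hσ : ∀ a : Fin mo → Fin n, ∃ σ : Equiv.Perm (Fin k), (∀ r, ∃ i, A (a i) = r) →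
      CloseTo C ρ σ (seed fun i => x (a i)) := fun a => by
    by_cases ha : ∀ r, ∃ i, A (a i) = r
    · obtain ⟨σ, hσ⟩ := hsep.exists_closeTo_seed ha (hseed _)
      exact ⟨σ, fun _ => hσ⟩
    · exact ⟨1, fun h => absurd h ha⟩
  choose σ hσ using hσ
  have hq1 : q ≤ 1 := by linarith [Real.exp_pos (-(m * pMin A))]
  have hqs : q * c' ≤ t_o := by nlinarith
  have hW : 0 ≤ ∑ r, (size A r : ℝ) * ρ r ^ 2 := Finset.sum_nonneg fun _ _ => by positivity
  obtain ⟨K, hK0, hK⟩ := exists_le_div_of_recursion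
    (u := fun t => ∫ ω, seededDist C A σ (fun i => ν i ω)
      (iterate x seed near c' t_o ν S t ω) ∂μ) hto0 hqc hqs hW
    (h.integral_seededDist_succ_le hsep hst hn hnear hc' ht_o hto0 hq hσ)
  refine ⟨(μ.real (seedHits A ν))⁻¹ * K, by positivity, fun t => ?_⟩
  rw [mul_div_assoc]
  exact (h.integral_cond_le c' t_o t σ).trans
    (mul_le_mul_of_nonneg_left (hK t) (by positivity))

end Convergence

end KMeans

/-! ### Convergence of mini-batch `k`-means with Buckshot seeding -/

theorem theorem2 {Ω : Type*} [MeasurableSpace Ω] (μ : Measure Ω) [IsProbabilityMeasure μ]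
    {d n k mo m : ℕ} (hk : 0 < k)
    -- the dataset, the stationary point and its clustering
    (x : Fin n → EuclideanSpace ℝ (Fin d)) (Cstar : Fin k → EuclideanSpace ℝ (Fin d))
    (Astar : Fin n → Fin k) (f α ξ δ β c' t_o : ℝ)
    (hB : Clusterable x Cstar Astar f α)
    -- no cluster is a single repeated point, so that each `w_r` is defined
    (hw : ∀ r, ∃ i, Astar i = r ∧ x i ≠ Cstar r)
    (hξ0 : 0 < ξ) (hξ1 : ξ < 1)
    (hf : 5 * √(1 / (2 * wMin x Cstar Astar) *
      Real.log (2 / (ξ * pMin Astar) * Real.log (2 * k / ξ))) ≤ f)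
    (hβ : 2 ≤ β) (hδ0 : 0 < δ) (hδ1 : δ < 1 / Real.exp 1)
    -- the size of the seeding sample
    (hmo_gt : Real.log (2 * k / ξ) / pMin Astar < mo)
    (hmo_lt : mo < ξ / 2 * Real.exp (2 * (f / 4 - 1) ^ 2 * wMin x Cstar Astar ^ 2))
    -- the mini-batch size and the learning rate
    (hm : Real.log (1 - √α) / Real.log (1 - 4 / 5 * pMin Astar) < m)
    (hden : 0 < 1 - √α - Real.exp (-(4 / 5 * m * pMin Astar)))
    (hc' : β / (2 * (1 - √α - Real.exp (-(4 / 5 * m * pMin Astar)))) < c')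
    (ht_o : 867 * c' ^ 2 * (n : ℝ) ^ 2 * Real.log (1 / δ) ^ 2 ≤ t_o)
    -- the algorithm: Buckshot seeding, nearest-centroid rule, and uniform independent samples
    (seed : (Fin mo → EuclideanSpace ℝ (Fin d)) → Fin k → EuclideanSpace ℝ (Fin d))
    (hseed : ∀ y, IsBuckshotSeed y (seed y))
    (near : (Fin k → EuclideanSpace ℝ (Fin d)) → EuclideanSpace ℝ (Fin d) → Fin k)
    (hnear : IsNearestRule near)
    (ν : Fin mo → Ω → Fin n) (S : ℕ → Fin m → Ω → Fin n)
    (hsample : IsUniformSampling μ ν S) :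
    ∃ G : ℕ → Set Ω,
      (∀ t, 1 ≤ t →
        MeasurableSet (G t) ∧ (1 - δ) * (1 - ξ) ≤ μ.real (G t) ∧
        Integrable (fun ω => cost x (iterate x seed near c' t_o ν S t ω)) (μ[|G t]) ∧
        Integrable (fun ω => centroidalDist Astar (iterate x seed near c' t_o ν S t ω) Cstar)
          (μ[|G t]) ∧
        (∫ ω, cost x (iterate x seed near c' t_o ν S t ω) ∂(μ[|G t])) - cost x Cstar ≤
          ∫ ω, centroidalDist Astar (iterate x seed near c' t_o ν S t ω) Cstar ∂(μ[|G t])) ∧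
      ((fun t : ℕ =>
          ∫ ω, centroidalDist Astar (iterate x seed near c' t_o ν S t ω) Cstar ∂(μ[|G t]))
        =O[atTop] fun t : ℕ => 1 / (t : ℝ)) ∧
      -- if `Cstar` is an optimal solution, then the cost converges to the optimal cost
      ((∀ C : Fin k → EuclideanSpace ℝ (Fin d), cost x Cstar ≤ cost x C) →
        (fun t : ℕ =>
          (∫ ω, cost x (iterate x seed near c' t_o ν S t ω) ∂(μ[|G t])) - cost x Cstar)
        =O[atTop] fun t : ℕ => 1 / (t : ℝ)) := by
  have hst := hB.stationary
  have hn : 0 < n := by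
    obtain ⟨i, -⟩ := hst.nonempty ⟨0, hk⟩
    exact i.pos
  have hn1 : (1 : ℝ) ≤ n := by exact_mod_cast hn
  have hk' : (0 : ℝ) < k := by exact_mod_cast hk
  have hp := hst.pMin_pos hk
  have hsep := hB.wellSeparated hw hξ0 hξ1 hf
  have hδlt : δ < 1 := hδ1.trans_le
    ((div_le_one (Real.exp_pos 1)).2 (Real.one_le_exp zero_le_one))
  -- the seeding sample hits every cluster with probability at least `1 - ξ / 2`
  have hG : 1 - ξ / 2 ≤ μ.real (seedHits Astar ν) := by
    refine le_trans ?_ (hsample.le_real_seedHits hn Astar)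
    rw [div_lt_iff₀ hp] at hmo_gt
    have h1 : Real.exp (-(mo * pMin Astar)) ≤ (2 * k / ξ)⁻¹ := by
      rw [Real.exp_neg]
      refine inv_anti₀ (by positivity) ?_
      rw [← Real.log_le_iff_le_exp (by positivity)]
      exact hmo_gt.le
    have h2 := mul_le_mul_of_nonneg_left h1 hk'.le
    have h3 : (k : ℝ) * (2 * k / ξ)⁻¹ = ξ / 2 := by field_simp
    linarith
  have hG' : (1 - δ) * (1 - ξ) ≤ μ.real (seedHits Astar ν) := by nlinarith
  have hG0 : 0 < μ.real (seedHits Astar ν) := by linarith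
  have hprob : IsProbabilityMeasure (μ[|seedHits Astar ν]) :=
    cond_isProbabilityMeasure fun h0 => by simp [measureReal_def, h0] at hG0
  -- the learning rate: `q` bounds from below the probability that a batch hits a given cluster
  set q := 1 - Real.exp (-(4 / 5 * m * pMin Astar)) with hqdef
  have hα := Real.sqrt_nonneg α
  have hexp := Real.exp_pos (-(4 / 5 * m * pMin Astar))
  have hc'den : 1 < c' * (1 - √α - Real.exp (-(4 / 5 * m * pMin Astar))) := by
    rw [div_lt_iff₀ (by positivity)] at hc'
    linarith
  have hc1 : 1 < c' := by nlinarith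
  have hqc : 1 < q * c' := by nlinarith
  have hq : Real.exp (-(m * pMin Astar)) ≤ 1 - q := by
    rw [hqdef, sub_sub_cancel, Real.exp_le_exp]
    have : 0 ≤ (m : ℝ) * pMin Astar := by positivity
    linarith
  have hto : c' ≤ t_o := by
    refine le_trans ?_ ht_o
    have h1 : 1 ≤ Real.log (1 / δ) := by
      rw [Real.le_log_iff_exp_le (by positivity), le_div_iff₀ hδ0]
      rw [lt_div_iff₀ (Real.exp_pos 1)] at hδ1
      linarith
    have h2 : 1 ≤ (n : ℝ) ^ 2 * Real.log (1 / δ) ^ 2 :=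
      one_le_mul_of_one_le_of_one_le (one_le_pow₀ hn1) (one_le_pow₀ h1)
    nlinarith
  have hto0 : 0 < t_o := by linarith
  obtain ⟨K, hK0, hK⟩ := hsample.exists_integral_centroidalDist_le hsep hst hn hseed hnear
    (by linarith : 0 ≤ c') hto hto0 hqc hq
  have hcost : ∀ t, Integrable (fun ω => cost x (iterate x seed near c' t_o ν S t ω))
      (μ[|seedHits Astar ν]) := fun t => hsample.integrable_iterate c' t_o t (cost x)
  have hdist : ∀ t, Integrable (fun ω => centroidalDist Astar
      (iterate x seed near c' t_o ν S t ω) Cstar) (μ[|seedHits Astar ν]) := fun t =>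
    hsample.integrable_iterate c' t_o t fun C => centroidalDist Astar C Cstar
  have hle : ∀ t, (∫ ω, cost x (iterate x seed near c' t_o ν S t ω) ∂(μ[|seedHits Astar ν])) -
      cost x Cstar ≤ ∫ ω, centroidalDist Astar (iterate x seed near c' t_o ν S t ω) Cstar
        ∂(μ[|seedHits Astar ν]) := fun t => by
    have h1 := integral_mono ((hcost t).sub (integrable_const (cost x Cstar))) (hdist t)
      fun ω => hst.cost_sub_le (iterate x seed near c' t_o ν S t ω)
    rw [integral_sub' (hcost t) (integrable_const _), integral_const] at h1
    simpa using h1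
  have hbig : ∀ u : ℕ → ℝ, (∀ t, 0 ≤ u t) → (∀ t : ℕ, u t ≤ K / (t + t_o)) →
      u =O[atTop] fun t : ℕ => 1 / (t : ℝ) := fun u h0 hu => by
    refine IsBigO.of_bound K ((eventually_gt_atTop 0).mono fun t ht => ?_)
    have ht' : (0 : ℝ) < t := by exact_mod_cast ht
    rw [Real.norm_of_nonneg (h0 t), Real.norm_of_nonneg (by positivity), mul_one_div]
    exact (hu t).trans (div_le_div_of_nonneg_left hK0 ht' (by linarith))
  refine ⟨fun _ => seedHits Astar ν, fun t _ => ⟨hsample.measurableSet_seedHits Astar, hG',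
    hcost t, hdist t, hle t⟩, hbig _ (fun t => integral_nonneg fun ω => centroidalDist_nonneg _) hK,
    fun hopt => hbig _ (fun t => ?_) fun t => (hle t).trans (hK t)⟩
  have h1 := integral_mono (integrable_const (cost x Cstar)) (hcost t) fun ω => hopt _
  simpa using h1
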